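/- Let $\Sigma=\{1,\dots,N\}$ index sources and $\Pi=\{1,\dots,M\}$ index sinks. Let $X=(X_i)_{i\in\Sigma}$ have an arbitrary joint distribution $p$ on a product of finite alphabets $\prod_{i}\mathcal X_i$, and let $X^n$ be $n$ i.i.d. copies of $X$; source node $i$ observes $X_i^n$. Sink $j$ wants to reconstruct $(X_i^n)_{i\in\Sigma_j}$, where $\Sigma_j\subseteq\Sigma$; put $\Pi_i=\{j : i\in\Sigma_j\}$. Suppose that each sink receives packets only from the sources it reconstructs. That is, a code of length $n$ for dispersive information routing (DIR) consists of positive integers $L_{i,K}$ for $i\in\Sigma$ and $\emptyset\ne K\subseteq\Pi_i$; of encoders $f_i^E:\mathcal X_i^n\to\prod_{\emptyset\neq K\subseteq\Pi_i}\{1,\dots,L_{i,K}\}$, whose component $T_{i,K}$ is a packet delivered exactly to the sinks in $K$; and of decoders $f_j^D$ that map the received packets $(T_{i,K})_{i\in\Sigma_j,\,j\in K\subseteq\Pi_i}$ to an estimate of $(X_i^n)_{i\in\Sigma_j}$. Its error probability is $P_e=\frac1M\sum_{j}P(\text{the estimate at sink } j\text{ is wrong})$. A rate tuple $R=(R_{i,K})_{i\in\Sigma,\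 \emptyset\ne K\subseteq\Pi_i}$ is achievable if for all $\eta>0$ and $0<\epsilon<1$ there is, for every sufficiently large $n$, a code of length $n$ with $\frac1n\log_2 L_{i,K}\le R_{i,K}+\eta$ for all $i,K$ and $P_e<\epsilon$. Then: (a) The set of achievable rate tuples is exactly the set of tuples $R$ with all $R_{i,K}\ge0$ such that, for every sink $j$ and every nonempty $S\subseteq\Sigma_j$, $$\sum_{i\in S}\ \sum_{K\subseteq\Pi_i,\ K\ni j}R_{i,K}\ \ge\ H\bigl(X_S\mid X_{\Sigma_j\setminus S}\bigr),$$ where $H$ is entropy in bits and $X_S=(X_i)_{i\in S}$. (b) Every tuple of this region is achieved by power binning. In power binning with typicality parameter $\delta$ and bin numbers $L_{i,K}$, every sequence in $\mathcal X_i^n$ is assigned, for each nonempty $K\subseteq\Pi_i$, an index uniform on $\{1,\dots,L_{i,K}\}$, all indices being independent; encoder $i$ puts the indices of its observed sequence into the packets $T_{i,K}$ if the sequence is typical, and sends a fixed index otherwise; and sink $j$ outputs the unique jointly typical tuple in $\prod_{i\in\Sigma_j}\mathcal X_i^n$ whose indices agree with those received, or an arbitrary tuple if there is no unique such tuple. Here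 a sequence is typical for a distribution $q$ if the empirical frequency of each letter $b$ differs from $q(b)$ by at most $\delta q(b)$. For every $R$ in the region, all $\eta>0$ and $0<\epsilon<1$, and every sufficiently small $\delta>0$, there are, for every sufficiently large $n$, bin numbers with $\frac1n\log_2L_{i,K}\le R_{i,K}+\eta$ for all $i,K$ such that $P_e$, averaged over the random index assignment, is less than $\epsilon$. -/

import Mathlib

noncomputable section

namespace DIR

/-! ### Finite probability: laws, conditional entropy, typicality -/

/-- The law (probability mass function) of the random variable `f` when the sample point is
distributed according to the probability mass function `p`. -/
def law {α β : Type*} [Fintype α] (p : α → ℝ) (f : α → β) (b : β) : ℝ :=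
  open Classical in ∑ a with f a = b, p a

/-- The conditional entropy `H(f | g)` in bits: the expectation of
`- log₂ P(f, g) / P(g)`. Points `a` with `p a = 0` contribute `0`. -/
def condEntropy {α β γ : Type*} [Fintype α] (p : α → ℝ) (f : α → β) (g : α → γ) : ℝ :=
  - ∑ a, p a * Real.logb 2 (law p (fun a => (f a, g a)) (f a, g a) / law p g (g a))

/-- Strong (letter) typicality: the empirical frequency of every letter `b` is within relative
error `δ` of `q b`. In particular letters of probability `0` do not occur. -/
def IsTypical {β : Type*} {n : ℕ} (δ : ℝ) (q : β → ℝ) (y : Fin n → β) : Prop :=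
  ∀ b, |(Nat.card {t : Fin n // y t = b} : ℝ) / n - q b| ≤ δ * q b

/-- Probability of the block `x` of `n` independent draws from `p`. -/
def blockProb {α : Type*} {n : ℕ} (p : α → ℝ) (x : Fin n → α) : ℝ := ∏ t, p (x t)

/-! ### Codes -/

variable {N M : ℕ} {𝒳 : Fin N → Type*}

/-- A block code of length `n` for dispersive information routing. Sink `j` requests the sources
in `Sig j`. Source `i` emits one packet for every set of sinks `K ∈ pk i`; this packet carries an
index out of `L i K` possible ones and is delivered to exactly the sinks in `K`. Each encoder sees
only its own source; the decoder of sink `j` sees exactly the packets whose destination set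
contains `j`. (With `pk i` the family of all nonempty sets of sinks, every source may communicate
with every sink.) -/
structure Code (𝒳 : Fin N → Type*) (Sig : Fin M → Finset (Fin N))
    (pk : Fin N → Finset (Finset (Fin M))) (n : ℕ) where
  /-- number of values of each packet -/
  L : ∀ i, pk i → ℕ+
  /-- encoders -/
  enc : ∀ i, (Fin n → 𝒳 i) → ∀ K : pk i, Fin (L i K)
  /-- decoders -/
  dec : ∀ j, (∀ i, ∀ K : {K : pk i // j ∈ K.1}, Fin (L i K.1)) →
    ∀ i : Sig j, Fin n → 𝒳 i

/-- What sink `j` outputs when the sources emit the block `x`. -/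
def Code.estimate {Sig : Fin M → Finset (Fin N)} {pk : Fin N → Finset (Finset (Fin M))} {n : ℕ}
    (c : Code 𝒳 Sig pk n) (j : Fin M) (x : Fin n → ∀ i, 𝒳 i) : ∀ i : Sig j, Fin n → 𝒳 i :=
  c.dec j fun i K => c.enc i (fun t => x t i) K.1

/-- The probability of error of a code, averaged over the sinks, when the sources emit `n`
independent draws from the joint probability mass function `p`. -/
def Code.errorProb {Sig : Fin M → Finset (Fin N)} {pk : Fin N → Finset (Finset (Fin M))} {n : ℕ}
    [∀ i, Fintype (𝒳 i)] (p : (∀ i, 𝒳 i) → ℝ) (c : Code 𝒳 Sig pk n) : ℝ :=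
  open Classical in
  (1 / (M : ℝ)) * ∑ j : Fin M,
    ∑ x : Fin n → ∀ i, 𝒳 i with c.estimate j x ≠ fun (i : Sig j) t => x t i, blockProb p x

/-- Achievability of a rate tuple (in bits per source symbol) with codes whose packets are those
in `pk`. -/
def Achievable [∀ i, Fintype (𝒳 i)] (p : (∀ i, 𝒳 i) → ℝ) (Sig : Fin M → Finset (Fin N))
    (pk : Fin N → Finset (Finset (Fin M))) (R : ∀ i, pk i → ℝ) : Prop :=
  ∀ η : ℝ, 0 < η → ∀ ε : ℝ, 0 < ε → ε < 1 → ∃ n₀ : ℕ, ∀ n : ℕ, n₀ ≤ n →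
    ∃ c : Code 𝒳 Sig pk n,
      (∀ i K, 1 / (n : ℝ) * Real.logb 2 (c.L i K : ℝ) ≤ R i K + η) ∧ c.errorProb p < ε

/-! ### No helpers -/

/-- The set `Π_i` of sinks that request source `i`. -/
def requesters (Sig : Fin M → Finset (Fin N)) (i : Fin N) : Finset (Fin M) :=
  {j | i ∈ Sig j}

/-- The packets permitted when sinks receive packets only from sources they request: source `i`
emits a packet for each nonempty set of sinks `K ⊆ Π_i`. -/
def noHelperPackets (Sig : Fin M → Finset (Fin N)) (i : Fin N) : Finset (Finset (Fin M)) :=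
  {K | K.Nonempty ∧ K ⊆ requesters Sig i}

/-- The nonnegative rate tuples satisfying, for every sink `j` and every nonempty `S ⊆ Sig j`,
`∑_{i ∈ S} ∑_{K ⊆ Π_i, j ∈ K} R i K ≥ H(X_S | X_{Sig j - S})`. -/
def noHelperRegion [∀ i, Fintype (𝒳 i)] (p : (∀ i, 𝒳 i) → ℝ) (Sig : Fin M → Finset (Fin N)) :
    Set (∀ i, noHelperPackets Sig i → ℝ) :=
  {R | (∀ i K, 0 ≤ R i K) ∧
    ∀ j, ∀ S : Finset (Fin N), S ⊆ Sig j → S.Nonempty →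
      condEntropy p (S.restrict (π := 𝒳)) ((Sig j \ S).restrict (π := 𝒳)) ≤
        ∑ i ∈ S, ∑ K : noHelperPackets Sig i with j ∈ K.1, R i K}

/-! ### Power binning -/

/-- A binning: each sequence of source `i` is given one bin index for each nonempty `K ⊆ Π_i`. -/
abbrev Binning (𝒳 : Fin N → Type*) (Sig : Fin M → Finset (Fin N)) (n : ℕ)
    (L : ∀ i, noHelperPackets Sig i → ℕ+) : Type _ :=
  ∀ i, (Fin n → 𝒳 i) → ∀ K : noHelperPackets Sig i, Fin (L i K)

/-- The tuple of sequences `z` (for the sources requested by sink `j`) is jointly typical, and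
its bin indices are the received indices `T`. -/
def BinMatch [∀ i, Fintype (𝒳 i)] (p : (∀ i, 𝒳 i) → ℝ) {Sig : Fin M → Finset (Fin N)} {n : ℕ}
    (δ : ℝ) {L : ∀ i, noHelperPackets Sig i → ℕ+} (b : Binning 𝒳 Sig n L) (j : Fin M)
    (T : ∀ i, ∀ K : {K : noHelperPackets Sig i // j ∈ K.1}, Fin (L i K.1))
    (z : ∀ i : Sig j, Fin n → 𝒳 i) : Prop :=
  IsTypical δ (law p ((Sig j).restrict (π := 𝒳))) (fun t i => z i t) ∧
    ∀ (i : Sig j) (K : {K : noHelperPackets Sig i // j ∈ K.1}), b i (z i) K.1 = T i K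

/-- The code given by a binning. Encoder `i` sends the bin indices of its sequence if the
sequence is typical, and a fixed index otherwise (an encoding error). Decoder `j` outputs the
unique jointly typical tuple in the received bins; if there is none, or more than one, its output
is arbitrary (a decoding error). -/
def powerBinningCode [∀ i, Fintype (𝒳 i)] [∀ i, Nonempty (𝒳 i)] (p : (∀ i, 𝒳 i) → ℝ)
    {Sig : Fin M → Finset (Fin N)} {n : ℕ} (δ : ℝ) {L : ∀ i, noHelperPackets Sig i → ℕ+}
    (b : Binning 𝒳 Sig n L) : Code 𝒳 Sig (noHelperPackets Sig) n :=
  open Classical in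
  { L := L
    enc := fun i y K =>
      if IsTypical δ (law p fun x : ∀ i, 𝒳 i => x i) y then b i y K else ⟨0, (L i K).pos⟩
    dec := fun j T =>
      if h : ∃! z, BinMatch p δ b j T z then h.choose else Classical.arbitrary _ }

/-- The error probability of power binning with bin numbers `L`, averaged over a uniformly random
binning, that is, with all bin indices drawn independently and uniformly. -/
def powerBinningError [∀ i, Fintype (𝒳 i)] [∀ i, Nonempty (𝒳 i)] (p : (∀ i, 𝒳 i) → ℝ)
    (Sig : Fin M → Finset (Fin N)) (n : ℕ) (δ : ℝ) (L : ∀ i, noHelperPackets Sig i → ℕ+) : ℝ :=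
  open Classical in
  (1 / (Fintype.card (Binning 𝒳 Sig n L) : ℝ)) *
    ∑ b : Binning 𝒳 Sig n L, (powerBinningCode p δ b).errorProb p

/-- Achievability of a rate tuple by power binning: for every sufficiently small typicality
parameter and all large block lengths, random power binning with rates exceeding those of the
tuple by at most `η` has average error probability less than `ε`. -/
def AchievableByPowerBinning [∀ i, Fintype (𝒳 i)] [∀ i, Nonempty (𝒳 i)] (p : (∀ i, 𝒳 i) → ℝ)
    (Sig : Fin M → Finset (Fin N)) (R : ∀ i, noHelperPackets Sig i → ℝ) : Prop :=
  ∀ η : ℝ, 0 < η → ∀ ε : ℝ, 0 < ε → ε < 1 → ∃ δ₀ : ℝ, 0 < δ₀ ∧ ∀ δ : ℝ, 0 < δ → δ < δ₀ →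
    ∃ n₀ : ℕ, ∀ n : ℕ, n₀ ≤ n → ∃ L : ∀ i, noHelperPackets Sig i → ℕ+,
      (∀ i K, 1 / (n : ℝ) * Real.logb 2 (L i K : ℝ) ≤ R i K + η) ∧
        powerBinningError p Sig n δ L < ε

end DIR

end

noncomputable section

namespace DIR

/-! ### Block probabilities and laws of letterwise images -/

section Block

open Classical

variable {α β γ : Type*}

/-! Without helpers the problem splits into Slepian–Wolf problems, one per sink, coupled only
through the shared packets: source `i` speaks to sink `j` at total rate `∑_{K ∋ j} R i K`, and the
region asks that these sums satisfy the Slepian–Wolf inequalities at every sink.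

Converse: hand sink `j` the sources of `Sig j \ S` for free. The packets from `S` reaching `j` must
then determine the blocks of `S`. By the law of large numbers the conditional probability of the
block of `X_S` is about `2 ^ (-n H)`, with `H = H(X_S | X_{Sig j \ S})`, so an index with markedly
fewer than `2 ^ (n H)` values is correct only with small probability
(`sum_blockProb_le_of_recoverable`, `eventually_recoverable_lt`). No Fano inequality is needed.

Direct part: a typical block is decoded wrongly only if another typical block has the same indices.
Sort the rivals by the set `S` of sources where they differ from the truth. There are at most `2 ^
(n (1 + δ) H)` of them (`card_typical_le`), and each agrees with the received indices in at most a
fraction `1 / ∏ L i K` of all binnings (`card_agree_mul_le`). The union bound is exponentially small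
once every packet has some spare rate. The best binning beats the average, so power binning also
gives ordinary achievability. -/

theorem blockProb_nonneg {p : α → ℝ} (hp : ∀ a, 0 ≤ p a) {n : ℕ} (x : Fin n → α) :
    0 ≤ blockProb p x :=
  Finset.prod_nonneg fun _ _ => hp _

theorem blockProb_cons (p : α → ℝ) {n : ℕ} (a : α) (x : Fin n → α) :
    blockProb p (Fin.cons a x : Fin (n + 1) → α) = p a * blockProb p x := by
  simp [blockProb, Fin.prod_univ_succ]

variable [Fintype α]

theorem sum_blockProb (p : α → ℝ) (n : ℕ) :
    ∑ x : Fin n → α, blockProb p x = (∑ a, p a) ^ n := by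
  simp only [blockProb, Fintype.sum_pow]

theorem law_nonneg {p : α → ℝ} (hp : ∀ a, 0 ≤ p a) (f : α → β) (b : β) : 0 ≤ law p f b :=
  Finset.sum_nonneg fun _ _ => hp _

theorem le_law {p : α → ℝ} (hp : ∀ a, 0 ≤ p a) (f : α → β) (a : α) : p a ≤ law p f (f a) :=
  Finset.single_le_sum (f := p) (fun _ _ => hp _) (by simp)

/-- Push-forward formula for expectations. -/
theorem sum_law_mul [Fintype β] (p : α → ℝ) (f : α → β) (φ : β → ℝ) :
    ∑ b, law p f b * φ b = ∑ a, p a * φ (f a) := by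
  rw [← Finset.sum_fiberwise (s := Finset.univ) (g := f)]
  refine Finset.sum_congr rfl fun b _ => ?_
  rw [law, Finset.sum_mul]
  refine Finset.sum_congr rfl fun a ha => ?_
  rw [(Finset.mem_filter.1 ha).2]

theorem sum_law [Fintype β] (p : α → ℝ) (f : α → β) : ∑ b, law p f b = ∑ a, p a := by
  simpa using sum_law_mul p f 1

theorem law_law [Fintype β] (p : α → ℝ) (f : α → β) (g : β → γ) :
    law (law p f) g = law p (fun a => g (f a)) := by
  funext c
  have := sum_law_mul p f (fun b => if g b = c then 1 else 0)
  simpa [law, Finset.sum_filter] using this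

theorem law_eq_of_iff (p : α → ℝ) {f : α → β} {g : α → γ} {b : β} {c : γ}
    (h : ∀ a, f a = b ↔ g a = c) : law p f b = law p g c := by
  simp only [law, h]

/-- Blocks whose letterwise image is prescribed: the law of the image block is a product. -/
theorem sum_blockProb_image (p : α → ℝ) (f : α → β) {n : ℕ} (u : Fin n → β) :
    ∑ x : Fin n → α with (fun t => f (x t)) = u, blockProb p x = ∏ t, law p f (u t) := by
  simp only [law, Finset.prod_univ_sum, blockProb]
  refine Finset.sum_congr ?_ fun _ _ => rfl
  ext x
  simp [funext_iff]

theorem sum_fin_succ {n : ℕ} (F : (Fin (n + 1) → α) → ℝ) :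
    ∑ x, F x = ∑ a, ∑ x : Fin n → α, F (Fin.cons a x) := by
  rw [← Fintype.sum_prod_type']
  exact (Fintype.sum_equiv (Fin.consEquiv fun _ : Fin (n + 1) => α) _ _ fun _ => rfl).symm

/-! ### Variance, Chebyshev and the weak law of large numbers -/

/-- Makes the cross term vanish when the square in the variance is expanded. -/
theorem sum_blockProb_mul_sum {p : α → ℝ} (hp : ∑ a, p a = 1) {ψ : α → ℝ}
    (hψ : ∑ a, p a * ψ a = 0) (n : ℕ) :
    ∑ x : Fin n → α, blockProb p x * ∑ t, ψ (x t) = 0 := by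
  induction n with
  | zero => simp
  | succ n ih =>
    rw [sum_fin_succ]
    simp only [blockProb_cons, Fin.sum_univ_succ, Fin.cons_zero, Fin.cons_succ, mul_add,
      Finset.sum_add_distrib, mul_assoc, ← Finset.mul_sum, ih]
    have h : ∀ a, ∑ x : Fin n → α, blockProb p x * ψ a = ψ a := fun a => by
      rw [← Finset.sum_mul, sum_blockProb, hp, one_pow, one_mul]
    simp [h, hψ]

/-- The variance of a sum of independent centred variables. -/
theorem sum_blockProb_mul_sum_sq {p : α → ℝ} (hp : ∑ a, p a = 1) {ψ : α → ℝ}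
    (hψ : ∑ a, p a * ψ a = 0) (n : ℕ) :
    ∑ x : Fin n → α, blockProb p x * (∑ t, ψ (x t)) ^ 2 = n * ∑ a, p a * ψ a ^ 2 := by
  induction n with
  | zero => simp
  | succ n ih =>
    rw [sum_fin_succ]
    simp only [blockProb_cons, Fin.sum_univ_succ, Fin.cons_zero, Fin.cons_succ]
    have h : ∀ a, ∑ x : Fin n → α, p a * blockProb p x * (ψ a + ∑ t, ψ (x t)) ^ 2
        = p a * ψ a ^ 2 + p a * (n * ∑ a, p a * ψ a ^ 2) := fun a => by
      have e : ∀ x : Fin n → α, p a * blockProb p x * (ψ a + ∑ t, ψ (x t)) ^ 2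
          = p a * ψ a ^ 2 * blockProb p x
            + 2 * p a * ψ a * (blockProb p x * ∑ t, ψ (x t))
            + p a * (blockProb p x * (∑ t, ψ (x t)) ^ 2) := fun x => by ring
      simp only [e, Finset.sum_add_distrib, ← Finset.mul_sum, ih, sum_blockProb, hp,
        sum_blockProb_mul_sum hp hψ]
      ring
    simp only [h, Finset.sum_add_distrib, ← Finset.sum_mul, hp]
    push_cast
    ring

/-- Chebyshev's inequality for blocks of independent draws. -/
theorem chebyshev_block {p : α → ℝ} (hp : p ∈ stdSimplex ℝ α) (φ : α → ℝ) {r : ℝ} (hr : 0 < r)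
    {n : ℕ} (hn : 0 < n) :
    ∑ x : Fin n → α with r * n < |∑ t, φ (x t) - n * ∑ a, p a * φ a|, blockProb p x
      ≤ (∑ a, p a * (φ a - ∑ a, p a * φ a) ^ 2) / r ^ 2 / n := by
  set μ := ∑ a, p a * φ a with hμ
  have hn' : (0 : ℝ) < n := by exact_mod_cast hn
  have h0 : ∑ a, p a * (φ a - μ) = 0 := by
    simp only [mul_sub, Finset.sum_sub_distrib, ← Finset.sum_mul, hp.2, ← hμ]
    ring
  have h2 := sum_blockProb_mul_sum_sq hp.2 h0 n
  rw [div_div, le_div_iff₀ (by positivity)]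
  have hs : ∀ x : Fin n → α, ∑ t, (φ (x t) - μ) = ∑ t, φ (x t) - n * μ := fun x => by
    simp [Finset.sum_sub_distrib]
  simp only [hs] at h2
  have h3 : (∑ x : Fin n → α with r * n < |∑ t, φ (x t) - n * μ|, blockProb p x) * (r * n) ^ 2
      ≤ ∑ x : Fin n → α, blockProb p x * (∑ t, φ (x t) - n * μ) ^ 2 := by
    rw [Finset.sum_mul]
    refine (Finset.sum_le_sum fun x hx => ?_).trans
      (Finset.sum_le_sum_of_subset_of_nonneg (Finset.filter_subset _ _)
        fun x _ _ => mul_nonneg (blockProb_nonneg hp.1 x) (sq_nonneg _))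
    refine mul_le_mul_of_nonneg_left ?_ (blockProb_nonneg hp.1 x)
    rw [← sq_abs (∑ t, φ (x t) - n * μ)]
    exact pow_le_pow_left₀ (by positivity) (Finset.mem_filter.1 hx).2.le 2
  rw [h2] at h3
  refine le_of_mul_le_mul_right ?_ hn'
  calc _ = _ := ?_
    _ ≤ _ := h3
    _ = _ := mul_comm _ _
  ring

open Filter in
/-- The weak law of large numbers for blocks of independent draws. -/
theorem eventually_sum_deviation_lt {p : α → ℝ} (hp : p ∈ stdSimplex ℝ α) (φ : α → ℝ)
    {r ε : ℝ} (hr : 0 < r) (hε : 0 < ε) :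
    ∀ᶠ n : ℕ in atTop,
      ∑ x : Fin n → α with r * n < |∑ t, φ (x t) - n * ∑ a, p a * φ a|, blockProb p x < ε := by
  have h := (tendsto_const_div_atTop_nhds_zero_nat
    ((∑ a, p a * (φ a - ∑ a, p a * φ a) ^ 2) / r ^ 2)).eventually_lt_const hε
  filter_upwards [h, eventually_gt_atTop 0] with n h1 h2
  exact (chebyshev_block hp φ hr h2).trans_lt h1

/-! ### Typical blocks: their probability and their number -/

theorem natCard_eq_sum [Fintype β] {n : ℕ} (y : Fin n → β) (b : β) :
    (Nat.card {t : Fin n // y t = b} : ℝ) = ∑ t, if y t = b then 1 else 0 := by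
  rw [Nat.card_eq_fintype_card, Fintype.card_subtype]
  simp

open Filter in
/-- Long blocks are typical with high probability. -/
theorem eventually_atypical_lt [Fintype β] {p : α → ℝ} (hp : p ∈ stdSimplex ℝ α) (f : α → β)
    {δ ε : ℝ} (hδ : 0 < δ) (hε : 0 < ε) :
    ∀ᶠ n : ℕ in atTop,
      ∑ x : Fin n → α with ¬ IsTypical δ (law p f) (fun t => f (x t)), blockProb p x < ε := by
  have hc : (0 : ℝ) < Fintype.card β + 1 := by positivity
  have key : ∀ b : β, ∀ᶠ n : ℕ in atTop, ∑ x : Fin n → α with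
      ¬ |(Nat.card {t : Fin n // f (x t) = b} : ℝ) / n - law p f b| ≤ δ * law p f b,
        blockProb p x < ε / (Fintype.card β + 1) := by
    intro b
    have hμ : ∑ a, p a * (if f a = b then (1 : ℝ) else 0) = law p f b := by
      simp [law, Finset.sum_filter]
    -- A letter of probability `0` is allowed no deviation at all, so the law of large numbers does
    -- not apply; but a block containing such a letter has probability `0`.
    rcases (law_nonneg hp.1 f b).eq_or_lt with h0 | h0
    · refine Eventually.of_forall fun n => ?_
      rw [Finset.sum_eq_zero]
      · positivity
      intro x hx
      have hx := (Finset.mem_filter.1 hx).2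
      by_contra hne
      apply hx
      have : ∀ t, f (x t) ≠ b := by
        rintro t rfl
        have h1 : p (x t) ≤ 0 := by rw [h0]; exact le_law hp.1 f (x t)
        exact hne (Finset.prod_eq_zero (Finset.mem_univ t) (le_antisymm h1 (hp.1 _)))
      simp [← h0, this]
    · filter_upwards [eventually_sum_deviation_lt hp (fun a => if f a = b then (1 : ℝ) else 0)
        (mul_pos hδ h0) (div_pos hε hc), eventually_gt_atTop 0] with n hn hn0
      refine lt_of_le_of_lt ?_ hn
      refine Finset.sum_le_sum_of_subset_of_nonneg ?_ fun x _ _ => blockProb_nonneg hp.1 x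
      intro x hx
      have hx := (Finset.mem_filter.1 hx).2
      refine Finset.mem_filter.2 ⟨Finset.mem_univ _, ?_⟩
      rw [hμ]
      rw [natCard_eq_sum (fun t => f (x t)) b, not_le] at hx
      have hn' : (0 : ℝ) < n := by exact_mod_cast hn0
      have := mul_lt_mul_of_pos_right hx hn'
      rwa [← abs_of_pos hn', ← abs_mul, abs_of_pos hn', sub_mul, div_mul_cancel₀ _ hn'.ne',
        mul_comm (law p f b) (n : ℝ)] at this
  filter_upwards [eventually_all.2 key] with n hn
  calc ∑ x : Fin n → α with ¬ IsTypical δ (law p f) (fun t => f (x t)), blockProb p x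
      ≤ ∑ b : β, ∑ x : Fin n → α with
        ¬ |(Nat.card {t : Fin n // f (x t) = b} : ℝ) / n - law p f b| ≤ δ * law p f b,
          blockProb p x := by
        simp only [Finset.sum_filter]
        rw [Finset.sum_comm]
        refine Finset.sum_le_sum fun x _ => ?_
        have hnn : ∀ b ∈ (Finset.univ : Finset β), 0 ≤ (if
            ¬ |(Nat.card {t : Fin n // f (x t) = b} : ℝ) / n - law p f b| ≤ δ * law p f b then
              blockProb p x else 0) := fun b _ => by
          split_ifs
          exacts [le_rfl, blockProb_nonneg hp.1 x]
        by_cases h : IsTypical δ (law p f) (fun t => f (x t))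
        · rw [if_neg (not_not.2 h)]
          exact Finset.sum_nonneg hnn
        · rw [if_pos h]
          rw [IsTypical, not_forall] at h
          obtain ⟨b, hb⟩ := h
          refine le_trans ?_ (Finset.single_le_sum hnn (Finset.mem_univ b))
          rw [if_pos hb]
    _ ≤ ∑ _b : β, ε / (Fintype.card β + 1) := Finset.sum_le_sum fun b _ => (hn b).le
    _ < ε := by
        rw [Finset.sum_const, Finset.card_univ, nsmul_eq_mul, ← mul_div_assoc, div_lt_iff₀ hc]
        nlinarith

/-- A function of a typical block is typical. -/
theorem IsTypical.map [Fintype β] {p : α → ℝ} {n : ℕ} {δ : ℝ} {f : α → β}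
    {y : Fin n → β} (hy : IsTypical δ (law p f) y) (g : β → γ) :
    IsTypical δ (law p fun a => g (f a)) (fun t => g (y t)) := by
  intro c
  have h1 : (Nat.card {t : Fin n // g (y t) = c} : ℝ)
      = ∑ b with g b = c, (Nat.card {t : Fin n // y t = b} : ℝ) := by
    simp only [natCard_eq_sum]
    rw [Finset.sum_comm, Nat.card_eq_fintype_card, Fintype.card_subtype, Finset.card_filter]
    push_cast
    refine Finset.sum_congr rfl fun t _ => ?_
    simp [Finset.sum_ite_eq]
  rw [← law_law, h1, law, Finset.sum_div, ← Finset.sum_sub_distrib, Finset.mul_sum]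
  exact (Finset.abs_sum_le_sum_abs _ _).trans (Finset.sum_le_sum fun b _ => hy b)

/-- Number of typical blocks with a prescribed letterwise image, bounded through the conditional
entropy of the letter given its image. -/
theorem card_typical_le [Fintype β] {p : α → ℝ} (hp : p ∈ stdSimplex ℝ α) (f : α → β)
    (g : β → γ) {n : ℕ} (hn : 0 < n) {δ : ℝ} (v : Fin n → γ)
    (Y : Finset (Fin n → β)) (hY : ∀ y ∈ Y, IsTypical δ (law p f) y)
    (hYv : ∀ y ∈ Y, ∀ t, g (y t) = v t) :
    (Y.card : ℝ) ≤ 2 ^ ((n : ℝ) * ((1 + δ) * condEntropy p f (fun a => g (f a)))) := by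
  set q := law p f with hq
  -- `w b` is the conditional probability of `b` given its image. Each typical block has weight `∏
  -- w` at least `2 ^ (-n (1 + δ) H)`, while all blocks over `v` together weigh at most `1`;
  -- dividing gives the count.
  set w : β → ℝ := fun b => q b / law q g (g b) with hw
  have hq0 : ∀ b, 0 ≤ q b := law_nonneg hp.1 f
  have hn' : (0 : ℝ) < n := by exact_mod_cast hn
  have hw0 : ∀ b, 0 ≤ w b := fun b => div_nonneg (hq0 b) (law_nonneg hq0 _ _)
  have hw1 : ∀ b, w b ≤ 1 := fun b => div_le_one_of_le₀ (le_law hq0 g b) (law_nonneg hq0 _ _)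
  have hH : condEntropy p f (fun a => g (f a)) = - ∑ b, q b * Real.logb 2 (w b) := by
    rw [condEntropy, hq, sum_law_mul]
    congr 1
    refine Finset.sum_congr rfl fun a _ => ?_
    rw [hw]
    simp only
    rw [hq, law_law]
    congr 3
    exact law_eq_of_iff p fun a' => by simp only [Prod.mk.injEq]; grind
  set H := condEntropy p f (fun a => g (f a)) with hHdef
  have hlow : ∀ y : Fin n → β, IsTypical δ q y →
      (2 : ℝ) ^ (-((n : ℝ) * ((1 + δ) * H))) ≤ ∏ t, w (y t) := by
    intro y hy
    have hpos : ∀ t, 0 < w (y t) := by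
      intro t
      have hqt : 0 < q (y t) := by
        refine (hq0 _).lt_of_ne fun h => ?_
        have h1 := hy (y t)
        rw [← h, mul_zero, sub_zero, abs_nonpos_iff, div_eq_zero_iff] at h1
        have h2 : 0 < Nat.card {s : Fin n // y s = y t} :=
          Nat.card_pos_iff.2 ⟨⟨⟨t, rfl⟩⟩, inferInstance⟩
        rcases h1 with h1 | h1
        · exact h2.ne' (by exact_mod_cast h1)
        · exact hn'.ne' h1
      exact div_pos hqt (hqt.trans_le (le_law hq0 g _))
    have hprod : 0 < ∏ t, w (y t) := Finset.prod_pos fun t _ => hpos t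
    rw [← Real.le_logb_iff_rpow_le (by norm_num) hprod, Real.logb_prod _ _ fun t _ => (hpos t).ne']
    have hsum : ∑ t, Real.logb 2 (w (y t))
        = ∑ b, (Nat.card {t : Fin n // y t = b} : ℝ) * Real.logb 2 (w b) := by
      simp only [natCard_eq_sum, Finset.sum_mul]
      rw [Finset.sum_comm]
      simp
    rw [hsum, hH, mul_neg, mul_neg, neg_neg, Finset.mul_sum, Finset.mul_sum]
    refine Finset.sum_le_sum fun b _ => ?_
    rw [← mul_assoc, ← mul_assoc]
    -- Since `log w ≤ 0`, only the upper bound on the letter frequencies matters.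
    refine mul_le_mul_of_nonpos_right ?_ (Real.logb_nonpos (by norm_num) (hw0 b) (hw1 b))
    have := (abs_le.1 (hy b)).2
    rw [sub_le_iff_le_add, div_le_iff₀ hn'] at this
    linarith
  have htot : ∑ y : Fin n → β with (fun t => g (y t)) = v, ∏ t, w (y t) ≤ 1 := by
    have := sum_blockProb_image w g v
    simp only [blockProb] at this
    rw [this]
    refine Finset.prod_le_one (fun t _ => law_nonneg hw0 _ _) fun t _ => ?_
    have : law w g (v t) = law q g (v t) / law q g (v t) := by
      rw [law, law, Finset.sum_div]
      refine Finset.sum_congr rfl fun b hb => ?_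
      simp only [hw]
      rw [(Finset.mem_filter.1 hb).2]
      rfl
    rw [this]
    -- The factor is `1`, or `0 / 0 = 0` if the letter `v t` has probability `0`.
    exact div_self_le_one _
  have h2 : (0 : ℝ) < 2 ^ (-((n : ℝ) * ((1 + δ) * H))) := by positivity
  rw [← inv_inv ((2 : ℝ) ^ ((n : ℝ) * ((1 + δ) * H))), ← Real.rpow_neg (by norm_num),
    ← one_div, le_div_iff₀ h2]
  refine le_trans ?_ htot
  rw [← nsmul_eq_mul, ← Finset.sum_const]
  refine (Finset.sum_le_sum fun y hy => hlow y (hY y hy)).trans ?_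
  refine Finset.sum_le_sum_of_subset_of_nonneg (fun y hy => ?_) fun y _ _ =>
    Finset.prod_nonneg fun t _ => hw0 _
  exact Finset.mem_filter.2 ⟨Finset.mem_univ _, funext (hYv y hy)⟩

/-! ### Recovering blocks from short indices -/

/-- If `f`-blocks can be recovered from an index out of `τ` and the `g`-block on the set `G`, and
the conditional probability of `f` given `g` is at most `B` there, then `G` has probability at
most `|τ| B`. -/
theorem sum_blockProb_le_of_recoverable [Fintype β] [Fintype γ] {p : α → ℝ}
    (hp : p ∈ stdSimplex ℝ α) (f : α → β) (g : α → γ) {n : ℕ} {τ : Type*} [Fintype τ]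
    (T : (Fin n → α) → τ) (G : Finset (Fin n → α))
    (hT : ∀ x ∈ G, ∀ x' ∈ G, T x = T x' → (∀ t, g (x t) = g (x' t)) → ∀ t, f (x t) = f (x' t))
    {B : ℝ} (hB : 0 ≤ B)
    (hG : ∀ x ∈ G, ∏ t, (law p (fun a => (f a, g a)) (f (x t), g (x t)) / law p g (g (x t))) ≤ B) :
    ∑ x ∈ G, blockProb p x ≤ Fintype.card τ * B := by
  -- On a fibre of `F` within `G` the `f`-block is constant, so the fibre lies in one event for the
  -- pair `(f, g)`, of probability at most `B` times that of its `g`-block. Summing over `g`-blocks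
  -- gives `B` for each index.
  set F : (Fin n → α) → τ × (Fin n → γ) := fun x => (T x, fun t => g (x t)) with hF
  have hfib : ∀ c : τ × (Fin n → γ), ∑ x ∈ G with F x = c, blockProb p x
      ≤ B * ∏ t, law p g (c.2 t) := by
    intro c
    rcases (G.filter fun x => F x = c).eq_empty_or_nonempty with h | ⟨x₀, hx₀⟩
    · rw [h, Finset.sum_empty]
      exact mul_nonneg hB (Finset.prod_nonneg fun t _ => law_nonneg hp.1 _ _)
    · obtain ⟨h₀, rfl⟩ := Finset.mem_filter.1 hx₀
      calc ∑ x ∈ G with F x = F x₀, blockProb p x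
          ≤ ∑ x : Fin n → α with (fun t => (f (x t), g (x t))) = fun t => (f (x₀ t), g (x₀ t)),
              blockProb p x := by
            refine Finset.sum_le_sum_of_subset_of_nonneg (fun x hx => ?_) fun x _ _ =>
              blockProb_nonneg hp.1 x
            obtain ⟨hx, hxF⟩ := Finset.mem_filter.1 hx
            simp only [hF, Prod.mk.injEq] at hxF
            have hg : ∀ t, g (x t) = g (x₀ t) := fun t => congrFun hxF.2 t
            refine Finset.mem_filter.2 ⟨Finset.mem_univ _, funext fun t => ?_⟩
            rw [hg t, hT x hx x₀ h₀ hxF.1 hg t]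
        _ = ∏ t, law p (fun a => (f a, g a)) (f (x₀ t), g (x₀ t)) := by
            convert sum_blockProb_image p (fun a => (f a, g a)) fun t => (f (x₀ t), g (x₀ t))
        _ = (∏ t, (law p (fun a => (f a, g a)) (f (x₀ t), g (x₀ t)) / law p g (g (x₀ t))))
              * ∏ t, law p g (g (x₀ t)) := by
            rw [← Finset.prod_mul_distrib]
            refine Finset.prod_congr rfl fun t _ => ?_
            rcases eq_or_ne (law p g (g (x₀ t))) 0 with h | h
            · rw [h, mul_zero]
              refine le_antisymm ?_ (law_nonneg hp.1 _ _)
              rw [← h]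
              refine Finset.sum_le_sum_of_subset_of_nonneg (fun a ha => ?_) fun a _ _ => hp.1 a
              simp only [Finset.mem_filter, Prod.mk.injEq] at ha ⊢
              exact ⟨ha.1, ha.2.2⟩
            · rw [div_mul_cancel₀ _ h]
        _ ≤ B * ∏ t, law p g ((F x₀).2 t) :=
            mul_le_mul_of_nonneg_right (hG x₀ h₀)
              (Finset.prod_nonneg fun t _ => law_nonneg hp.1 _ _)
  calc ∑ x ∈ G, blockProb p x = ∑ c, ∑ x ∈ G with F x = c, blockProb p x :=
        (Finset.sum_fiberwise _ _ _).symm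
    _ ≤ ∑ c : τ × (Fin n → γ), B * ∏ t, law p g (c.2 t) := Finset.sum_le_sum fun c _ => hfib c
    _ = Fintype.card τ * B := by
        have : ∑ v : Fin n → γ, ∏ t, law p g (v t) = 1 := by
          rw [← Fintype.sum_pow, sum_law, hp.2, one_pow]
        rw [Fintype.sum_prod_type]
        simp only [← Finset.mul_sum, this]
        simp [mul_comm]

open Filter in
/-- Asymptotically, a set of blocks on which the `f`-block can be recovered from the `g`-block and
an index with at most `2 ^ (n (H(f | g) - 2 r))` values has small probability. -/
theorem eventually_recoverable_lt [Fintype β] [Fintype γ] {p : α → ℝ}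
    (hp : p ∈ stdSimplex ℝ α) (f : α → β) (g : α → γ) {r ε : ℝ} (hr : 0 < r) (hε : 0 < ε) :
    ∀ᶠ n : ℕ in atTop, ∀ (τ : Type) [Fintype τ] (T : (Fin n → α) → τ) (G : Finset (Fin n → α)),
      (∀ x ∈ G, ∀ x' ∈ G, T x = T x' → (∀ t, g (x t) = g (x' t)) → ∀ t, f (x t) = f (x' t)) →
      (Fintype.card τ : ℝ) ≤ 2 ^ ((n : ℝ) * (condEntropy p f g - 2 * r)) →
      ∑ x ∈ G, blockProb p x < ε := by
  set w : α → ℝ := fun a => law p (fun a => (f a, g a)) (f a, g a) / law p g (g a) with hw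
  have hexp : ∀ᶠ n : ℕ in atTop, ((2 : ℝ) ^ (-r)) ^ n < ε / 2 :=
    (tendsto_pow_atTop_nhds_zero_of_lt_one (by positivity)
      (Real.rpow_lt_one_of_one_lt_of_neg (by norm_num) (by linarith))).eventually_lt_const
      (half_pos hε)
  filter_upwards [eventually_sum_deviation_lt hp (fun a => Real.logb 2 (w a)) hr (half_pos hε),
    hexp] with n h1 h2 τ _ T G hT hcard
  have hμ : ∑ a, p a * Real.logb 2 (w a) = - condEntropy p f g := by simp [condEntropy, hw]
  rw [hμ] at h1
  set H := condEntropy p f g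
  -- The exceptional blocks, whose conditional log-probability is far from `-n H`; they are
  -- negligible, and outside them the conditional probability is at most `2 ^ (-n (H - r))`.
  set A : Finset (Fin n → α) :=
    {x | r * n < |∑ t, Real.logb 2 (w (x t)) - n * -H|} with hA
  have hsplit : ∑ x ∈ G, blockProb p x
      ≤ ∑ x ∈ A, blockProb p x + ∑ x ∈ G \ A, blockProb p x := by
    rw [← Finset.sum_union Finset.disjoint_sdiff]
    refine Finset.sum_le_sum_of_subset_of_nonneg (fun x hx => ?_) fun x _ _ =>
      blockProb_nonneg hp.1 x
    by_cases h : x ∈ A <;> simp [h, hx]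
  have hmain := sum_blockProb_le_of_recoverable hp f g T (G \ A)
    (fun x hx x' hx' => hT x (Finset.mem_sdiff.1 hx).1 x' (Finset.mem_sdiff.1 hx').1)
    (B := 2 ^ (-(n : ℝ) * (H - r))) (by positivity) (fun x hx => by
      have hx : ¬ r * n < |∑ t, Real.logb 2 (w (x t)) - n * -H| := fun h =>
        (Finset.mem_sdiff.1 hx).2 (Finset.mem_filter.2 ⟨Finset.mem_univ _, h⟩)
      have hx := (abs_le.1 (not_lt.1 hx)).2
      change ∏ t, w (x t) ≤ _
      have hw0 : ∀ a, 0 ≤ w a := fun a => div_nonneg (law_nonneg hp.1 _ _) (law_nonneg hp.1 _ _)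
      -- A vanishing product has to be split off before logarithms are taken.
      rcases (Finset.prod_nonneg fun t _ => hw0 (x t)).eq_or_lt with h | h
      · rw [← h]; positivity
      · rw [← Real.logb_le_iff_le_rpow (by norm_num) h, Real.logb_prod _ _ fun t ht h0 => h.ne'
          (Finset.prod_eq_zero ht h0)]
        linarith)
  have hfin : (Fintype.card τ : ℝ) * 2 ^ (-(n : ℝ) * (H - r)) ≤ ((2 : ℝ) ^ (-r)) ^ n := by
    refine (mul_le_mul_of_nonneg_right hcard (by positivity)).trans (le_of_eq ?_)
    rw [← Real.rpow_add (by norm_num), ← Real.rpow_mul_natCast (by norm_num)]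
    congr 1
    ring
  linarith

end Block

/-! ### Packets reaching a sink, and the converse -/

section Coding

open Classical

variable {N M : ℕ} {𝒳 : Fin N → Type*} {Sig : Fin M → Finset (Fin N)}

/-- This index set serves twice: as the side information of the converse, and as the free choice of
indices when binnings are counted. -/
theorem card_packets (L : ∀ i, noHelperPackets Sig i → ℕ+) (j : Fin M) (S : Finset (Fin N)) :
    Fintype.card (∀ i : S, ∀ K : {K : noHelperPackets Sig i // j ∈ K.1}, Fin (L i K.1))
      = ∏ i ∈ S, ∏ K : noHelperPackets Sig i with j ∈ K.1, (L i K : ℕ) := by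
  simp only [Fintype.card_pi, Fintype.card_fin]
  rw [← Finset.prod_coe_sort S]
  refine Finset.prod_congr rfl fun i _ => ?_
  exact (Finset.prod_subtype _ (fun K => by simp) fun K => (L i K : ℕ)).symm

theorem card_packets_le {L : ∀ i, noHelperPackets Sig i → ℕ+} {R : ∀ i, noHelperPackets Sig i → ℝ}
    {n : ℕ} (hn : 0 < n) {η : ℝ}
    (hL : ∀ i K, 1 / (n : ℝ) * Real.logb 2 (L i K : ℝ) ≤ R i K + η)
    {j : Fin M} {S : Finset (Fin N)} :
    (Fintype.card (∀ i : S, ∀ K : {K : noHelperPackets Sig i // j ∈ K.1}, Fin (L i K.1)) : ℝ)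
      ≤ 2 ^ ((n : ℝ) * ((∑ i ∈ S, ∑ K : noHelperPackets Sig i with j ∈ K.1, R i K)
        + (∑ i ∈ S, ∑ K : noHelperPackets Sig i with j ∈ K.1, (1 : ℝ)) * η)) := by
  have hn' : (0 : ℝ) < n := by exact_mod_cast hn
  rw [card_packets]
  push_cast
  calc ∏ i ∈ S, ∏ K : noHelperPackets Sig i with j ∈ K.1, (L i K : ℝ)
      ≤ ∏ i ∈ S, ∏ K : noHelperPackets Sig i with j ∈ K.1,
          (2 : ℝ) ^ ((n : ℝ) * (R i K + η)) := by
        refine Finset.prod_le_prod (fun i _ => Finset.prod_nonneg fun K _ => by positivity)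
          fun i _ => Finset.prod_le_prod (fun K _ => by positivity) fun K _ => ?_
        have h0 : (0 : ℝ) < L i K := by exact_mod_cast (L i K).pos
        rw [← Real.logb_le_iff_le_rpow (by norm_num) h0]
        have := hL i K
        rwa [one_div, inv_mul_le_iff₀ hn'] at this
    _ = _ := by
        simp only [← Real.rpow_sum_of_pos (show (0 : ℝ) < 2 by norm_num), ← Finset.mul_sum,
          Finset.sum_add_distrib]
        congr 3
        simp only [Finset.sum_mul, one_mul]

theorem mem_requesters {i : Fin N} {j : Fin M} : j ∈ requesters Sig i ↔ i ∈ Sig j := by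
  simp [requesters]

/-- This is where the absence of helpers enters. -/
theorem mem_sig_of_mem_packet {i : Fin N} {j : Fin M} (K : noHelperPackets Sig i)
    (h : j ∈ K.1) : i ∈ Sig j := by
  have := K.2
  simp only [noHelperPackets, Finset.mem_filter] at this
  exact mem_requesters.1 (this.2.2 h)

variable [∀ i, Fintype (𝒳 i)] {p : (∀ i, 𝒳 i) → ℝ}

theorem sum_sink_error_nonneg (hp : p ∈ stdSimplex ℝ (∀ i, 𝒳 i)) {n : ℕ}
    (c : Code 𝒳 Sig (noHelperPackets Sig) n) (j : Fin M) :
    0 ≤ ∑ x : Fin n → ∀ i, 𝒳 i with c.estimate j x ≠ fun (i : Sig j) t => x t i,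
      blockProb p x :=
  Finset.sum_nonneg fun x _ => blockProb_nonneg hp.1 x

open Filter in
/-- The converse: achievable tuples satisfy the entropy inequalities. -/
theorem mem_noHelperRegion_of_achievable (hp : p ∈ stdSimplex ℝ (∀ i, 𝒳 i))
    {R : ∀ i, noHelperPackets Sig i → ℝ} (h : Achievable p Sig (noHelperPackets Sig) R) :
    R ∈ noHelperRegion p Sig := by
  constructor
  · intro i K
    refine le_of_forall_pos_le_add fun η hη => ?_
    obtain ⟨n, hn⟩ := h η hη (1 / 2) (by norm_num) (by norm_num)
    obtain ⟨c, hc, -⟩ := hn n le_rfl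
    refine le_trans ?_ (hc i K)
    have : (1 : ℝ) ≤ c.L i K := by exact_mod_cast (c.L i K).pos
    have := Real.logb_nonneg (b := 2) (by norm_num) this
    positivity
  · intro j S hS _
    by_contra! hlt
    set f := S.restrict (π := 𝒳)
    set g := (Sig j \ S).restrict (π := 𝒳)
    set ρ := ∑ i ∈ S, ∑ K : noHelperPackets Sig i with j ∈ K.1, R i K with hρ
    set H := condEntropy p f g with hH
    set C : ℝ := ∑ i ∈ S, ∑ K : noHelperPackets Sig i with j ∈ K.1, (1 : ℝ) with hC
    have hC0 : 0 ≤ C := Finset.sum_nonneg fun i _ => Finset.sum_nonneg fun _ _ => zero_le_one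
    have hΔ : 0 < H - ρ := sub_pos.2 hlt
    have hM : (0 : ℝ) < M := by exact_mod_cast j.pos
    have hM1 : (1 : ℝ) ≤ M := by exact_mod_cast j.pos
    -- `C` counts the packets from `S` reaching `j`. With `r = (H - ρ) / 3`, this slack keeps their
    -- total rate `ρ + C η` at most `H - 2 r`; the `+ 1` covers `C = 0`.
    set η := (H - ρ) / 3 / (C + 1) with hη
    have hC1 : 0 < C + 1 := add_pos_of_nonneg_of_pos hC0 one_pos
    have hr : 0 < (H - ρ) / 3 := div_pos hΔ three_pos
    have hη0 : 0 < η := div_pos hr hC1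
    have hCη : C * η ≤ (H - ρ) / 3 := by
      rw [hη, ← mul_div_assoc, div_le_iff₀ hC1, mul_comm C]
      exact mul_le_mul_of_nonneg_left (le_add_of_nonneg_right zero_le_one) hr.le
    -- Average error below `1 / (2 M)` over `M` sinks forces error below `1 / 2` at sink `j`.
    obtain ⟨n₀, hn₀⟩ := h η hη0 (1 / (2 * M)) (by positivity)
      ((div_lt_one (by positivity)).2 (by linarith))
    -- The recoverability bound is uniform in the index and the set, so `n` can be fixed before the
    -- code.
    obtain ⟨n, hrec, hnn, hn0⟩ := ((eventually_recoverable_lt hp f g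
      hr (ε := 1 / 2) (by norm_num)).and
      ((eventually_ge_atTop n₀).and (eventually_gt_atTop 0))).exists
    obtain ⟨c, hrate, herr⟩ := hn₀ n hnn
    have hn' : (0 : ℝ) < n := by exact_mod_cast hn0
    have hcorrect := hrec (∀ i : S, ∀ K : {K : noHelperPackets Sig i // j ∈ K.1}, Fin (c.L i K.1))
      (fun x i K => c.enc i (fun t => x t i) K.1)
      {x | c.estimate j x = fun (i : Sig j) t => x t i} (by
        intro x hx x' hx' hT hg t
        have hx := (Finset.mem_filter.1 hx).2
        have hx' := (Finset.mem_filter.1 hx').2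
        have hest : c.estimate j x = c.estimate j x' := by
          unfold Code.estimate
          congr 1
          funext i K
          -- Each packet received at `j` comes either from `S`, where the indices agree, or from
          -- `Sig j \ S`, where the source blocks themselves agree.
          have hi := mem_sig_of_mem_packet K.1 K.2
          by_cases hiS : i ∈ S
          · exact congrFun (congrFun hT ⟨i, hiS⟩) K
          · have : (fun t => x t i) = fun t => x' t i := funext fun t =>
              congrFun (hg t) ⟨i, Finset.mem_sdiff.2 ⟨hi, hiS⟩⟩
            rw [this]
        rw [hx, hx'] at hest
        funext i
        exact congrFun (congrFun hest ⟨i, hS i.2⟩) t) (by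
        refine (card_packets_le hn0 hrate).trans ?_
        refine Real.rpow_le_rpow_of_exponent_le (by norm_num)
          (mul_le_mul_of_nonneg_left ?_ hn'.le)
        linarith)
    have hsink : ∑ x : Fin n → ∀ i, 𝒳 i with c.estimate j x ≠ fun (i : Sig j) t => x t i,
        blockProb p x < 1 / 2 := by
      have h1 := Finset.single_le_sum (f := fun j => ∑ x : Fin n → ∀ i, 𝒳 i with
        c.estimate j x ≠ fun (i : Sig j) t => x t i, blockProb p x)
        (fun j _ => sum_sink_error_nonneg hp c j) (Finset.mem_univ j)
      rw [Code.errorProb, one_div_mul_eq_div, div_lt_iff₀ hM] at herr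
      have h2 : 1 / (2 * (M : ℝ)) * M = 1 / 2 := by field_simp
      rw [h2] at herr
      exact h1.trans_lt herr
    have htot : ∑ x : Fin n → ∀ i, 𝒳 i, blockProb p x = 1 := by rw [sum_blockProb, hp.2, one_pow]
    rw [← Finset.sum_filter_add_sum_filter_not Finset.univ
      (fun x => c.estimate j x = fun (i : Sig j) t => x t i)] at htot
    linarith

end Coding

/-! ### Power binning: the direct part -/

section PowerBinning

open Classical

variable {N M : ℕ} {𝒳 : Fin N → Type*} {Sig : Fin M → Finset (Fin N)} [∀ i, Fintype (𝒳 i)]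

/-- Two tuples of sequences receive the same indices at sink `j` in at most the expected fraction
of all binnings. -/
theorem card_agree_mul_le {n : ℕ} (L : ∀ i, noHelperPackets Sig i → ℕ+) (j : Fin M)
    (x z : ∀ i, Fin n → 𝒳 i) {S : Finset (Fin N)} (hS : ∀ i ∈ S, z i ≠ x i) :
    (Finset.univ.filter fun b : Binning 𝒳 Sig n L =>
        ∀ i (K : noHelperPackets Sig i), j ∈ K.1 → b i (z i) K = b i (x i) K).card
      * ∏ i ∈ S, ∏ K : noHelperPackets Sig i with j ∈ K.1, (L i K : ℕ)
      ≤ Fintype.card (Binning 𝒳 Sig n L) := by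
  rw [← card_packets, ← Fintype.card_coe, ← Fintype.card_prod]
  -- Overwrite the indices of `z i`, `i ∈ S`, by arbitrary values. Nothing is lost: the old values
  -- were those of `x i`, which survive because `x i ≠ z i`.
  refine Fintype.card_le_of_injective
    (fun bc i y K => if h : i ∈ S ∧ y = z i ∧ j ∈ K.1 then bc.2 ⟨i, h.1⟩ ⟨K, h.2.2⟩
      else bc.1.1 i y K) ?_
  rintro ⟨⟨b, hb⟩, c⟩ ⟨⟨b', hb'⟩, c'⟩ heq
  have hb := (Finset.mem_filter.1 hb).2
  have hb' := (Finset.mem_filter.1 hb').2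
  have heq : ∀ i y K, (if h : i ∈ S ∧ y = z i ∧ j ∈ K.1 then c ⟨i, h.1⟩ ⟨K, h.2.2⟩
      else b i y K) = (if h : i ∈ S ∧ y = z i ∧ j ∈ K.1 then c' ⟨i, h.1⟩ ⟨K, h.2.2⟩
      else b' i y K) := fun i y K => congrFun (congrFun (congrFun heq i) y) K
  have hc : c = c' := by
    funext i K
    simpa [i.2, K.2] using heq i (z i) K.1
  have hbb : b = b' := by
    funext i y K
    by_cases h : i ∈ S ∧ y = z i ∧ j ∈ K.1
    · obtain ⟨hi, rfl, hK⟩ := h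
      rw [hb i K hK, hb' i K hK]
      simpa [(hS i hi).symm] using heq i (x i) K
    · simpa [h] using heq i y K
  subst hc hbb
  rfl

variable {p : (∀ i, 𝒳 i) → ℝ}

/-- Given `X_{A \ S}`, knowing `X_A` amounts to knowing `X_S`. The left side is the form in which
typical blocks are counted, the right side that of the region. -/
theorem condEntropy_restrict₂ (p : (∀ i, 𝒳 i) → ℝ) {A S : Finset (Fin N)} (hS : S ⊆ A) :
    condEntropy p (A.restrict (π := 𝒳))
        (fun a => Finset.restrict₂ (π := 𝒳) (Finset.sdiff_subset : A \ S ⊆ A) (A.restrict a))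
      = condEntropy p (S.restrict (π := 𝒳)) ((A \ S).restrict (π := 𝒳)) := by
  unfold condEntropy
  congr 1
  refine Finset.sum_congr rfl fun a _ => ?_
  congr 3
  refine law_eq_of_iff p fun a' => ?_
  simp only [Prod.mk.injEq, funext_iff, Subtype.forall, Finset.restrict, Finset.restrict₂,
    Finset.mem_sdiff]
  constructor
  · rintro ⟨h, -⟩
    exact ⟨fun i hi => h i (hS hi), fun i hi => h i hi.1⟩
  · rintro ⟨h, h'⟩
    refine ⟨fun i hi => ?_, h'⟩
    by_cases hiS : i ∈ S
    exacts [h i hiS, h' i ⟨hi, hiS⟩]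

theorem condEntropy_nonneg {α β γ : Type*} [Fintype α] {p : α → ℝ} (hp : ∀ a, 0 ≤ p a)
    (f : α → β) (g : α → γ) : 0 ≤ condEntropy p f g := by
  rw [condEntropy, neg_nonneg]
  refine Finset.sum_nonpos fun a _ => mul_nonpos_of_nonneg_of_nonpos (hp a)
    (Real.logb_nonpos (by norm_num) (div_nonneg (law_nonneg hp _ _) (law_nonneg hp _ _))
      (div_le_one_of_le₀ ?_ (law_nonneg hp _ _)))
  refine Finset.sum_le_sum_of_subset_of_nonneg (fun a ha => ?_) fun a _ _ => hp a
  simp only [Finset.mem_filter, Prod.mk.injEq] at ha ⊢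
  exact ⟨ha.1, ha.2.2⟩

/-- The tuple of sequences that is `y` on the sources in `A` and `x` elsewhere. -/
def patch {n : ℕ} {A : Finset (Fin N)} (x : Fin n → ∀ i, 𝒳 i) (y : Fin n → ∀ i : A, 𝒳 i)
    (i : Fin N) (t : Fin n) : 𝒳 i :=
  if h : i ∈ A then y t ⟨i, h⟩ else x t i

/-- Binnings that confuse a block with typical blocks differing from it exactly in the sources
of `S`. -/
theorem sum_card_agree_le (hp : p ∈ stdSimplex ℝ (∀ i, 𝒳 i)) {n : ℕ} (hn : 0 < n) {δ : ℝ}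
    (L : ∀ i, noHelperPackets Sig i → ℕ+) {j : Fin M} (x : Fin n → ∀ i, 𝒳 i)
    {S : Finset (Fin N)} (hS : S ⊆ Sig j) (Y : Finset (Fin n → ∀ i : Sig j, 𝒳 i))
    (htyp : ∀ y ∈ Y, IsTypical δ (law p ((Sig j).restrict (π := 𝒳))) y)
    (hoff : ∀ y ∈ Y, ∀ t, ∀ i : Sig j, i.1 ∉ S → y t i = x t i)
    (hon : ∀ y ∈ Y, ∀ i ∈ S, patch x y i ≠ fun t => x t i) :
    ∑ y ∈ Y, ((Finset.univ.filter fun b : Binning 𝒳 Sig n L =>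
        ∀ i (K : noHelperPackets Sig i), j ∈ K.1 →
          b i (patch x y i) K = b i (fun t => x t i) K).card : ℝ)
      ≤ Fintype.card (Binning 𝒳 Sig n L) * (2 ^ ((n : ℝ) * ((1 + δ) *
            condEntropy p (S.restrict (π := 𝒳)) ((Sig j \ S).restrict (π := 𝒳))))
          / ∏ i ∈ S, ∏ K : noHelperPackets Sig i with j ∈ K.1, (L i K : ℝ)) := by
  have hL : (0 : ℝ) < ∏ i ∈ S, ∏ K : noHelperPackets Sig i with j ∈ K.1, (L i K : ℝ) :=
    Finset.prod_pos fun i _ => Finset.prod_pos fun K _ => Nat.cast_pos.2 (L i K).pos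
  have h1 : ∀ y ∈ Y, ((Finset.univ.filter fun b : Binning 𝒳 Sig n L =>
        ∀ i (K : noHelperPackets Sig i), j ∈ K.1 →
          b i (patch x y i) K = b i (fun t => x t i) K).card : ℝ)
      ≤ Fintype.card (Binning 𝒳 Sig n L)
        / ∏ i ∈ S, ∏ K : noHelperPackets Sig i with j ∈ K.1, (L i K : ℝ) := by
    intro y hy
    rw [le_div_iff₀ hL]
    have := card_agree_mul_le L j (fun i t => x t i) (patch x y) (hon y hy)
    have := (Nat.cast_le (α := ℝ)).2 this
    simpa only [Nat.cast_mul, Nat.cast_prod] using this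
  have h2 := card_typical_le hp ((Sig j).restrict (π := 𝒳))
    (Finset.restrict₂ (π := 𝒳) (Finset.sdiff_subset : Sig j \ S ⊆ Sig j)) hn
    (fun t => (Sig j \ S).restrict (x t)) Y htyp fun y hy t => funext fun i =>
      hoff y hy t ⟨i, (Finset.mem_sdiff.1 i.2).1⟩ (Finset.mem_sdiff.1 i.2).2
  rw [condEntropy_restrict₂ p hS] at h2
  refine (Finset.sum_le_card_nsmul _ _ _ h1).trans ?_
  rw [nsmul_eq_mul]
  refine (mul_le_mul_of_nonneg_right h2 (div_nonneg (Nat.cast_nonneg _) hL.le)).trans_eq ?_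
  rw [mul_div_left_comm]

variable [∀ i, Nonempty (𝒳 i)]

/-- If the block at sink `j` is typical and decoded wrongly, then some other typical block has the
same indices. -/
theorem exists_confusable {n : ℕ} {δ : ℝ} {L : ∀ i, noHelperPackets Sig i → ℕ+}
    (b : Binning 𝒳 Sig n L) {j : Fin M} {x : Fin n → ∀ i, 𝒳 i}
    (hx : IsTypical δ (law p ((Sig j).restrict (π := 𝒳))) (fun t => (Sig j).restrict (x t)))
    (herr : (powerBinningCode p δ b).estimate j x ≠ fun (i : Sig j) t => x t i) :
    ∃ y : Fin n → ∀ i : Sig j, 𝒳 i, IsTypical δ (law p ((Sig j).restrict (π := 𝒳))) y ∧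
      (∃ i : Sig j, (fun t => y t i) ≠ fun t => x t i) ∧
      ∀ i (K : noHelperPackets Sig i), j ∈ K.1 → b i (patch x y i) K = b i (fun t => x t i) K := by
  set T : ∀ i, ∀ K : {K : noHelperPackets Sig i // j ∈ K.1}, Fin (L i K.1) :=
    fun i K => (powerBinningCode p δ b).enc i (fun t => x t i) K.1 with hTdef
  -- Joint typicality at the sink makes each requested source typical, so no encoder falls back on
  -- the fixed index.
  have hT : ∀ i (K : {K : noHelperPackets Sig i // j ∈ K.1}),
      T i K = b i (fun t => x t i) K.1 := by
    intro i K
    have hi := mem_sig_of_mem_packet K.1 K.2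
    exact if_pos (hx.map fun a : ∀ i : Sig j, 𝒳 i => a ⟨i, hi⟩)
  have hmatch : BinMatch p δ b j T fun (i : Sig j) t => x t i := ⟨hx, fun i K => (hT i K).symm⟩
  have hdec : (powerBinningCode p δ b).estimate j x
      = if h : ∃! z, BinMatch p δ b j T z then h.choose else Classical.arbitrary _ := rfl
  have hex : ∃ z, BinMatch p δ b j T z ∧ z ≠ fun (i : Sig j) t => x t i := by
    by_contra! hno
    have hu : ∃! z, BinMatch p δ b j T z := ⟨_, hmatch, hno⟩
    rw [dif_pos hu] at hdec
    exact herr (hdec.trans (hno _ hu.choose_spec.1))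
  obtain ⟨z, hz, hne⟩ := hex
  refine ⟨fun t i => z i t, hz.1, ?_, fun i K hK => ?_⟩
  · by_contra! h
    exact hne (funext h)
  · have hi := mem_sig_of_mem_packet K hK
    have h1 : patch x (fun t (i : Sig j) => z i t) i = z ⟨i, hi⟩ := by
      funext t
      simp [patch, hi]
    rw [h1]
    exact (hz.2 ⟨i, hi⟩ ⟨K, hK⟩).trans (hT i ⟨K, hK⟩)

/-- Union bound for the number of binnings under which a typical block is decoded wrongly. -/
theorem card_error_le (hp : p ∈ stdSimplex ℝ (∀ i, 𝒳 i)) {n : ℕ} (hn : 0 < n) {δ : ℝ}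
    (L : ∀ i, noHelperPackets Sig i → ℕ+) {j : Fin M} {x : Fin n → ∀ i, 𝒳 i}
    (hx : IsTypical δ (law p ((Sig j).restrict (π := 𝒳))) (fun t => (Sig j).restrict (x t))) :
    ((Finset.univ.filter fun b : Binning 𝒳 Sig n L =>
        (powerBinningCode p δ b).estimate j x ≠ fun (i : Sig j) t => x t i).card : ℝ)
      ≤ Fintype.card (Binning 𝒳 Sig n L) * ∑ S ∈ (Sig j).powerset.filter Finset.Nonempty,
          2 ^ ((n : ℝ) * ((1 + δ) *
            condEntropy p (S.restrict (π := 𝒳)) ((Sig j \ S).restrict (π := 𝒳))))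
          / ∏ i ∈ S, ∏ K : noHelperPackets Sig i with j ∈ K.1, (L i K : ℝ) := by
  set Y : Finset (Fin N) → Finset (Fin n → ∀ i : Sig j, 𝒳 i) := fun S => Finset.univ.filter
    fun y => IsTypical δ (law p ((Sig j).restrict (π := 𝒳))) y ∧
      (∀ t, ∀ i : Sig j, i.1 ∉ S → y t i = x t i) ∧
      ∀ i ∈ S, patch x y i ≠ fun t => x t i with hY
  set E : (Fin n → ∀ i : Sig j, 𝒳 i) → Finset (Binning 𝒳 Sig n L) := fun y =>
    Finset.univ.filter fun b => ∀ i (K : noHelperPackets Sig i), j ∈ K.1 →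
      b i (patch x y i) K = b i (fun t => x t i) K with hE
  have hsub : (Finset.univ.filter fun b : Binning 𝒳 Sig n L =>
        (powerBinningCode p δ b).estimate j x ≠ fun (i : Sig j) t => x t i)
      ⊆ ((Sig j).powerset.filter Finset.Nonempty).biUnion fun S => (Y S).biUnion E := by
    intro b hb
    obtain ⟨y, hy, ⟨i₀, hi₀⟩, hagree⟩ := exists_confusable b hx (Finset.mem_filter.1 hb).2
    have hpatch : ∀ i : Sig j, patch x y i = fun t => y t i := fun i => by
      funext t
      simp [patch]
    -- The class of the rival `y` is the exact set of sources on which it differs from `x`.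
    refine Finset.mem_biUnion.2 ⟨(Sig j).filter fun i => patch x y i ≠ fun t => x t i, ?_,
      Finset.mem_biUnion.2 ⟨y, ?_, Finset.mem_filter.2 ⟨Finset.mem_univ _, hagree⟩⟩⟩
    · refine Finset.mem_filter.2 ⟨Finset.mem_powerset.2 (Finset.filter_subset _ _), i₀, ?_⟩
      exact Finset.mem_filter.2 ⟨i₀.2, by rwa [hpatch]⟩
    · refine Finset.mem_filter.2 ⟨Finset.mem_univ _, hy, fun t i hiS => ?_, fun i hi =>
        (Finset.mem_filter.1 hi).2⟩
      have : patch x y i = fun t => x t i := by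
        by_contra h
        exact hiS (Finset.mem_filter.2 ⟨i.2, h⟩)
      rw [hpatch i] at this
      exact congrFun this t
  have hcard := (Finset.card_le_card hsub).trans (Finset.card_biUnion_le.trans
    (Finset.sum_le_sum fun S _ => Finset.card_biUnion_le))
  refine ((Nat.cast_le (α := ℝ)).2 hcard).trans ?_
  rw [Finset.mul_sum, Nat.cast_sum]
  refine Finset.sum_le_sum fun S hS => ?_
  rw [Nat.cast_sum]
  exact sum_card_agree_le hp hn L x (Finset.mem_powerset.1 (Finset.mem_filter.1 hS).1) (Y S)
    (fun y hy => (Finset.mem_filter.1 hy).2.1) (fun y hy => (Finset.mem_filter.1 hy).2.2.1)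
    (fun y hy => (Finset.mem_filter.1 hy).2.2.2)

/-- The error probability of power binning at one sink, averaged over all binnings. -/
theorem average_sink_error_le (hp : p ∈ stdSimplex ℝ (∀ i, 𝒳 i)) {n : ℕ} (hn : 0 < n) {δ : ℝ}
    (L : ∀ i, noHelperPackets Sig i → ℕ+) (j : Fin M) :
    (1 / (Fintype.card (Binning 𝒳 Sig n L) : ℝ)) * ∑ b : Binning 𝒳 Sig n L,
        ∑ x : Fin n → ∀ i, 𝒳 i with
          (powerBinningCode p δ b).estimate j x ≠ fun (i : Sig j) t => x t i, blockProb p x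
      ≤ ∑ x : Fin n → ∀ i, 𝒳 i with ¬ IsTypical δ (law p ((Sig j).restrict (π := 𝒳)))
            (fun t => (Sig j).restrict (x t)), blockProb p x
        + ∑ S ∈ (Sig j).powerset.filter Finset.Nonempty,
          2 ^ ((n : ℝ) * ((1 + δ) *
            condEntropy p (S.restrict (π := 𝒳)) ((Sig j \ S).restrict (π := 𝒳))))
          / ∏ i ∈ S, ∏ K : noHelperPackets Sig i with j ∈ K.1, (L i K : ℝ) := by
  set U := ∑ S ∈ (Sig j).powerset.filter Finset.Nonempty,
          (2 : ℝ) ^ ((n : ℝ) * ((1 + δ) *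
            condEntropy p (S.restrict (π := 𝒳)) ((Sig j \ S).restrict (π := 𝒳))))
          / ∏ i ∈ S, ∏ K : noHelperPackets Sig i with j ∈ K.1, (L i K : ℝ) with hU
  have hU0 : 0 ≤ U := Finset.sum_nonneg fun S _ => by positivity
  set B := (Fintype.card (Binning 𝒳 Sig n L) : ℝ) with hB
  have hB0 : 0 < B := by
    have : Nonempty (Binning 𝒳 Sig n L) := ⟨fun i _ K => ⟨0, (L i K).pos⟩⟩
    exact Nat.cast_pos.2 Fintype.card_pos
  rw [one_div_mul_eq_div, div_le_iff₀ hB0]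
  have hswap : ∑ b : Binning 𝒳 Sig n L, ∑ x : Fin n → ∀ i, 𝒳 i with
        (powerBinningCode p δ b).estimate j x ≠ fun (i : Sig j) t => x t i, blockProb p x
      = ∑ x : Fin n → ∀ i, 𝒳 i, ((Finset.univ.filter fun b : Binning 𝒳 Sig n L =>
        (powerBinningCode p δ b).estimate j x ≠ fun (i : Sig j) t => x t i).card : ℝ)
          * blockProb p x := by
    simp only [Finset.sum_filter]
    rw [Finset.sum_comm]
    refine Finset.sum_congr rfl fun x _ => ?_
    rw [← Finset.sum_filter, Finset.sum_const, nsmul_eq_mul]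
  have htot : ∑ x : Fin n → ∀ i, 𝒳 i, blockProb p x = 1 := by rw [sum_blockProb, hp.2, one_pow]
  rw [hswap, add_mul, ← mul_one (U * B), ← htot, Finset.mul_sum, Finset.sum_filter,
    Finset.sum_mul, ← Finset.sum_add_distrib]
  refine Finset.sum_le_sum fun x _ => ?_
  have hx0 := blockProb_nonneg hp.1 x
  by_cases hx : IsTypical δ (law p ((Sig j).restrict (π := 𝒳))) (fun t => (Sig j).restrict (x t))
  · rw [if_neg (not_not.2 hx), zero_mul, zero_add, mul_comm U]
    exact mul_le_mul_of_nonneg_right (card_error_le hp hn L hx) hx0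
  · rw [if_pos hx]
    have h1 : ((Finset.univ.filter fun b : Binning 𝒳 Sig n L =>
        (powerBinningCode p δ b).estimate j x ≠ fun (i : Sig j) t => x t i).card : ℝ) ≤ B := by
      exact Nat.cast_le.2 (Finset.card_le_univ _)
    have := mul_le_mul_of_nonneg_right h1 hx0
    have : 0 ≤ U * B * blockProb p x := by positivity
    linarith [mul_comm B (blockProb p x)]

open Filter in
/-- The direct part: power binning achieves every tuple of the region. -/
theorem achievableByPowerBinning (hp : p ∈ stdSimplex ℝ (∀ i, 𝒳 i))
    {R : ∀ i, noHelperPackets Sig i → ℝ} (hR : R ∈ noHelperRegion p Sig) :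
    AchievableByPowerBinning p Sig R := by
  intro η hη ε hε _
  set H : Fin M → Finset (Fin N) → ℝ := fun j S =>
    condEntropy p (S.restrict (π := 𝒳)) ((Sig j \ S).restrict (π := 𝒳)) with hH
  have hH0 : ∀ j S, 0 ≤ H j S := fun j S => condEntropy_nonneg hp.1 _ _
  set Q : ℝ := ∑ j, ∑ S, H j S with hQ
  have hHQ : ∀ j S, H j S ≤ Q := fun j S =>
    (Finset.single_le_sum (f := H j) (fun S _ => hH0 j S) (Finset.mem_univ S)).trans
      (Finset.single_le_sum (f := fun j => ∑ S, H j S)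
        (fun j _ => Finset.sum_nonneg fun S _ => hH0 j S) (Finset.mem_univ j))
  have hQ0 : 0 ≤ Q := Finset.sum_nonneg fun j _ => Finset.sum_nonneg fun S _ => hH0 j S
  -- `Q` dominates every conditional entropy involved, so the typicality loss `δ H` is at most `η /
  -- 4`.
  refine ⟨η / 4 / (Q + 1), by positivity, fun δ hδ hδ' => ?_⟩
  have hδQ : δ * Q ≤ η / 4 := by
    rw [lt_div_iff₀ (by positivity)] at hδ'
    nlinarith
  set c : ℝ := 2 ^ N with hc
  have hc0 : 0 < c := by positivity
  have hexp : ∀ᶠ n : ℕ in atTop, ((2 : ℝ) ^ (-(η / 4))) ^ n < ε / 2 / c :=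
    (tendsto_pow_atTop_nhds_zero_of_lt_one (by positivity)
      (Real.rpow_lt_one_of_one_lt_of_neg (by norm_num) (by linarith))).eventually_lt_const
      (by positivity)
  have htyp : ∀ᶠ n : ℕ in atTop, ∀ j, ∑ x : Fin n → ∀ i, 𝒳 i with
      ¬ IsTypical δ (law p ((Sig j).restrict (π := 𝒳))) (fun t => (Sig j).restrict (x t)),
        blockProb p x < ε / 2 :=
    eventually_all.2 fun j => eventually_atypical_lt hp _ hδ (half_pos hε)
  -- The condition `n ≥ 2 / η` gives `2 ≤ 2 ^ (n η / 2)`, which pays for rounding the bin numbers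
  -- up.
  obtain ⟨n₀, hn₀⟩ := eventually_atTop.1 (hexp.and (htyp.and ((eventually_gt_atTop 0).and
    (tendsto_natCast_atTop_atTop.eventually_ge_atTop (2 / η)))))
  refine ⟨n₀, fun n hn => ?_⟩
  obtain ⟨he, ht, hn0, hnη⟩ := hn₀ n hn
  have hn' : (0 : ℝ) < n := by exact_mod_cast hn0
  set L : ∀ i, noHelperPackets Sig i → ℕ+ := fun i K =>
    ⟨⌈(2 : ℝ) ^ ((n : ℝ) * (R i K + η / 2))⌉₊, Nat.ceil_pos.2 (by positivity)⟩ with hL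
  have hLge : ∀ i K, (2 : ℝ) ^ ((n : ℝ) * (R i K + η / 2)) ≤ L i K := fun i K => Nat.le_ceil _
  have hLle : ∀ i K, (L i K : ℝ) ≤ 2 ^ ((n : ℝ) * (R i K + η)) := by
    intro i K
    have h1 : (1 : ℝ) ≤ 2 ^ ((n : ℝ) * (R i K + η / 2)) :=
      Real.one_le_rpow (by norm_num) (mul_nonneg hn'.le (by linarith [hR.1 i K]))
    have h2 : (L i K : ℝ) < 2 ^ ((n : ℝ) * (R i K + η / 2)) + 1 := Nat.ceil_lt_add_one (by positivity)
    have h3 : (2 : ℝ) * 2 ^ ((n : ℝ) * (R i K + η / 2)) ≤ 2 ^ ((n : ℝ) * (R i K + η)) := by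
      rw [← Real.rpow_one_add' (by norm_num) (by
        have := mul_nonneg hn'.le (hR.1 i K)
        have := mul_pos hn' hη
        linarith)]
      refine Real.rpow_le_rpow_of_exponent_le (by norm_num) ?_
      rw [div_le_iff₀ hη] at hnη
      linarith
    linarith
  refine ⟨L, fun i K => ?_, ?_⟩
  · have h0 : (0 : ℝ) < L i K := by exact_mod_cast (L i K).pos
    rw [one_div, inv_mul_le_iff₀ hn', Real.logb_le_iff_le_rpow (by norm_num) h0]
    exact hLle i K
  have hterm : ∀ j, ∀ S ∈ (Sig j).powerset.filter Finset.Nonempty,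
      (2 : ℝ) ^ ((n : ℝ) * ((1 + δ) * H j S))
        / ∏ i ∈ S, ∏ K : noHelperPackets Sig i with j ∈ K.1, (L i K : ℝ)
      ≤ ((2 : ℝ) ^ (-(η / 4))) ^ n := by
    intro j S hS
    obtain ⟨hSj, i₀, hi₀⟩ := Finset.mem_filter.1 hS
    have hSj := Finset.mem_powerset.1 hSj
    set ρ := ∑ i ∈ S, ∑ K : noHelperPackets Sig i with j ∈ K.1, R i K with hρ
    have hρH : H j S ≤ ρ := hR.2 j S hSj ⟨i₀, hi₀⟩
    have hprod : (2 : ℝ) ^ ((n : ℝ) * (ρ + η / 2))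
        ≤ ∏ i ∈ S, ∏ K : noHelperPackets Sig i with j ∈ K.1, (L i K : ℝ) := by
      -- The packet for `{j}` alone always exists, so the spare rate `η / 2` is gained at least
      -- once. After the loss of `η / 4` to typicality, an exponent of at most `-n η / 4` remains.
      have hmem : ({j} : Finset (Fin M)) ∈ noHelperPackets Sig i₀ := by
        simp [noHelperPackets, mem_requesters, hSj hi₀]
      have hone : η / 2 ≤ ∑ i ∈ S, ∑ K : noHelperPackets Sig i with j ∈ K.1, η / 2 := by
        have h1 : η / 2 ≤ ∑ K : noHelperPackets Sig i₀ with j ∈ K.1, η / 2 :=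
          Finset.single_le_sum (f := fun _ : noHelperPackets Sig i₀ => η / 2)
            (fun _ _ => by positivity)
            (Finset.mem_filter.2 ⟨Finset.mem_univ ⟨{j}, hmem⟩, Finset.mem_singleton_self j⟩)
        exact h1.trans (Finset.single_le_sum
          (f := fun i => ∑ K : noHelperPackets Sig i with j ∈ K.1, η / 2)
          (fun i _ => Finset.sum_nonneg fun _ _ => by positivity) hi₀)
      calc (2 : ℝ) ^ ((n : ℝ) * (ρ + η / 2))
          ≤ 2 ^ (∑ i ∈ S, ∑ K : noHelperPackets Sig i with j ∈ K.1,
              (n : ℝ) * (R i K + η / 2)) := by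
            refine Real.rpow_le_rpow_of_exponent_le (by norm_num) ?_
            simp only [← Finset.mul_sum, Finset.sum_add_distrib]
            refine mul_le_mul_of_nonneg_left ?_ hn'.le
            linarith
        _ = ∏ i ∈ S, ∏ K : noHelperPackets Sig i with j ∈ K.1,
              (2 : ℝ) ^ ((n : ℝ) * (R i K + η / 2)) := by
            simp only [Real.rpow_sum_of_pos (show (0 : ℝ) < 2 by norm_num)]
        _ ≤ _ := Finset.prod_le_prod (fun i _ => Finset.prod_nonneg fun K _ => by positivity)
            fun i _ => Finset.prod_le_prod (fun K _ => by positivity) fun K _ => hLge i K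
    refine (div_le_div_of_nonneg_left (by positivity) (by positivity) hprod).trans ?_
    rw [← Real.rpow_sub (by norm_num), ← Real.rpow_mul_natCast (by norm_num)]
    refine Real.rpow_le_rpow_of_exponent_le (by norm_num) ?_
    have h1 : δ * H j S ≤ η / 4 := (mul_le_mul_of_nonneg_left (hHQ j S) hδ.le).trans hδQ
    have h2 := mul_le_mul_of_nonneg_left
      (show (1 + δ) * H j S - (ρ + η / 2) ≤ -(η / 4) by linarith) hn'.le
    linarith
  have hsink : ∀ j, (1 / (Fintype.card (Binning 𝒳 Sig n L) : ℝ)) * ∑ b : Binning 𝒳 Sig n L,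
        ∑ x : Fin n → ∀ i, 𝒳 i with
          (powerBinningCode p δ b).estimate j x ≠ fun (i : Sig j) t => x t i, blockProb p x
      < ε := by
    intro j
    have h1 := Finset.sum_le_card_nsmul _ _ _ (hterm j)
    have h2 : (((Sig j).powerset.filter Finset.Nonempty).card : ℝ) ≤ c := by
      have := Finset.card_le_univ ((Sig j).powerset.filter Finset.Nonempty)
      rw [Fintype.card_finset, Fintype.card_fin] at this
      rw [hc]
      exact_mod_cast this
    rw [nsmul_eq_mul] at h1
    have h3 := h1.trans (mul_le_mul_of_nonneg_right h2 (by positivity))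
    rw [lt_div_iff₀ hc0] at he
    have h4 := average_sink_error_le (δ := δ) hp hn0 L j
    linarith [ht j]
  -- Without sinks the error is an empty sum.
  rcases Nat.eq_zero_or_pos M with rfl | hM
  · simpa [powerBinningError, Code.errorProb] using hε
  have hM' : (0 : ℝ) < M := by exact_mod_cast hM
  have hsum : powerBinningError p Sig n δ L = (1 / (M : ℝ)) * ∑ j,
      (1 / (Fintype.card (Binning 𝒳 Sig n L) : ℝ)) * ∑ b : Binning 𝒳 Sig n L,
        ∑ x : Fin n → ∀ i, 𝒳 i with
          (powerBinningCode p δ b).estimate j x ≠ fun (i : Sig j) t => x t i, blockProb p x := by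
    simp only [powerBinningError, Code.errorProb]
    rw [← Finset.mul_sum, ← Finset.mul_sum, Finset.sum_comm, mul_left_comm]
  rw [hsum, one_div_mul_eq_div, div_lt_iff₀ hM']
  have : Nonempty (Fin M) := ⟨⟨0, hM⟩⟩
  refine (Finset.sum_lt_sum_of_nonempty Finset.univ_nonempty fun j _ => hsink j).trans_eq ?_
  simp [mul_comm]

/-- Some binning does at least as well as the average over all binnings. -/
theorem AchievableByPowerBinning.achievable {R : ∀ i, noHelperPackets Sig i → ℝ}
    (h : AchievableByPowerBinning p Sig R) : Achievable p Sig (noHelperPackets Sig) R := by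
  intro η hη ε hε hε1
  obtain ⟨δ₀, hδ₀, hδ⟩ := h η hη ε hε hε1
  obtain ⟨n₀, hn₀⟩ := hδ (δ₀ / 2) (half_pos hδ₀) (half_lt_self hδ₀)
  refine ⟨n₀, fun n hn => ?_⟩
  obtain ⟨L, hL, herr⟩ := hn₀ n hn
  suffices ∃ b : Binning 𝒳 Sig n L, (powerBinningCode p (δ₀ / 2) b).errorProb p < ε by
    obtain ⟨b, hb⟩ := this
    exact ⟨powerBinningCode p (δ₀ / 2) b, hL, hb⟩
  by_contra! hno
  refine herr.not_ge ?_
  have hB : (0 : ℝ) < Fintype.card (Binning 𝒳 Sig n L) := by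
    have : Nonempty (Binning 𝒳 Sig n L) := ⟨fun i _ K => ⟨0, (L i K).pos⟩⟩
    exact_mod_cast Fintype.card_pos
  rw [powerBinningError, one_div_mul_eq_div, le_div_iff₀ hB]
  refine (le_of_eq ?_).trans (Finset.sum_le_sum fun b _ => hno b)
  rw [Finset.sum_const, Finset.card_univ, nsmul_eq_mul, mul_comm]

end PowerBinning

end DIR

end

theorem theorem2 {N M : ℕ} (𝒳 : Fin N → Type*) [∀ i, Fintype (𝒳 i)] [∀ i, Nonempty (𝒳 i)]
    (p : (∀ i, 𝒳 i) → ℝ) (hp : p ∈ stdSimplex ℝ (∀ i, 𝒳 i)) (Sig : Fin M → Finset (Fin N)) :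
    {R | DIR.Achievable p Sig (DIR.noHelperPackets Sig) R} = DIR.noHelperRegion p Sig ∧
      ∀ R ∈ DIR.noHelperRegion p Sig, DIR.AchievableByPowerBinning p Sig R :=
  ⟨Set.Subset.antisymm (fun _ hR => DIR.mem_noHelperRegion_of_achievable hp hR)
    fun _ hR => (DIR.achievableByPowerBinning hp hR).achievable,
    fun _ hR => DIR.achievableByPowerBinning hp hR⟩
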